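/- Conventions. Let $\operatorname{Li}_1(z)=-\log(1-z)$, $\operatorname{Li}_{k+1}(z)=\int_0^z \operatorname{Li}_k(u)\,\frac{du}{u}$ and $\operatorname{li}_k=-\operatorname{Li}_k/(2\pi i)$ (normalized polylogarithms, singular at $1$). For $\alpha\in\mathbb C$ put $\ell_k(z)=\operatorname{li}_k(1+(z-\alpha))$, a multivalued function on $0<|z-\alpha|<1$ (the principal branch and its analytic continuation). A holomorphic germ has an isolated singularity at $\alpha$ if it continues analytically along all paths of a punctured disc $0<|z-\alpha|<r$ (so it is a holomorphic function of $\log(z-\alpha)$), but the branch considered does not extend holomorphically to $\alpha$; $\Sigma_\alpha^k F$, $k\in\mathbb Z$, denotes its analytic continuation along a loop of winding number $k$ around $\alpha$. The singularity has recurrent monodromy if there are $d\ge1$ and constants $c_0,\dots,c_{d-1}\in\mathbb C$ with $\Sigma_\alpha^{m+d}F=\sum_{k=0}^{d-1}c_k\,\Sigma_\alpha^{m+k}F$ for all $m\ge 0$; for a subfield $K\subset\mathbb C$ it is $K$-recurrent if the $c_k$ can be chosen in $K$. A holomorphic germ $F$ at a point $z_0$ is in the recurrent monodromy class if all its singularities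 (the end points of paths from $z_0$ along which $F$ continues up to, but not including, the end point) are isolated with recurrent monodromy. Here one may consider the singularities of all branches, or only those of the principal branch (reached along segments from $z_0$), or those reached along any prescribed family of paths; the statement holds for each choice. A polylogarithm singularity at $\alpha$ is one near which, for some $0<r\le1$ and on $0<|z-\alpha|<r$, $$F(z)=(z-\alpha)^a\,P(\ell_1(z),\dots,\ell_n(z))\,\varphi(z),$$ with $a\in\mathbb C$, $P\in\mathbb C[X_1,\dots,X_n]$ and $\varphi$ holomorphic on $|z-\alpha|<r$, where $a,n,P,\varphi$ may depend on the singularity. Lemma. If $F$ has this form near $\alpha$ and $d=\deg P$, then for every $k\in\mathbb Z$, with $\lambda(z)=\log(1+(z-\alpha))$ (principal branch), $$\Sigma_\alpha^kF=e^{2\pi i k a}(z-\alpha)^a\,P\Big(\ell_1+k,\ \ell_2+k\lambda,\ \dots,\ \ell_n+k\frac{\lambda^{n-1}}{(n-1)!}\Big)\varphi(z),$$ and there is a polynomial $Q\in\mathbb C[T,X_1,\dots,X_n]$ with $P\big(\ell_1+k,\dots,\ell_n+k\lambda^{n-1}/(n-1)!\big)=Q(\lambda,\ell_1,\dots,\ell_n)$,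 whose degree in $T$ is at most $(n-1)d$, whose total degree in $(X_1,\dots,X_n)$ is $d$, and whose degree in each $X_j$ is that of $P$. Corollary. (i) If all singularities of $F$ are (isolated) polylogarithm singularities, then $F$ is in the recurrent monodromy class. (ii) Let $K\subset\mathbb C$ be a subfield. If at a polylogarithm singularity $\alpha$ the polynomial $P$ has coefficients in $K$ and $e^{2\pi i a}$ is algebraic over $K$ (for instance $e^{2\pi i a}\in K$), then the monodromy of $F$ at $\alpha$ is $K$-recurrent. -/

import Mathlib

open Filter Topology

noncomputable section

/-- The principal branch of the polylogarithm `Li_k` on the plane cut along `[1, ∞)`: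
`Li_1 z = -log (1 - z)` and `Li_{k+1} z = ∫_0^z Li_k u du / u`, along the segment `u = t z`.
(By the usual convention `Li_0 z = z / (1 - z)`; only `k ≥ 1` is used below.) -/
def polylog : ℕ → ℂ → ℂ
  | 0, z => z / (1 - z)
  | 1, z => -Complex.log (1 - z)
  | k + 2, z => ∫ t in (0 : ℝ)..1, polylog (k + 1) ((t : ℂ) * z) / (t : ℂ)

/-- Logarithmic coordinate of the point `u = 1 / 2`, seen from the singular point `1` of the
polylogarithms: `1 + exp logHalf = 1 / 2`. -/
def logHalf : ℂ := (Real.log (1 / 2) : ℂ) + (Real.pi : ℂ) * Complex.I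

/-- The polylogarithm `Li_k (1 + w)` as a multivalued function of `w` near its singularity `w = 0`,
that is, as a function of `ζ = log w` on the half-plane `Re ζ < 0` (the universal cover of
`0 < |w| < 1`). It is the analytic continuation of the principal branch, which corresponds to
`0 < Im ζ < 2π`: there `-log (1 - (1 + w)) = -(ζ - π i)`, and for the higher ones
`Li_{k+1} z = Li_{k+1} (1/2) + ∫_{1/2}^z Li_k u du / u` with `u = 1 + e^ξ`,
`du / u = e^ξ / (1 + e^ξ) dξ`, along the segment from `logHalf` to `ζ`. -/
def polylogCover : ℕ → ℂ → ℂ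
  | 0, ζ => (1 + Complex.exp ζ) / (-Complex.exp ζ)
  | 1, ζ => -(ζ - (Real.pi : ℂ) * Complex.I)
  | k + 2, ζ => polylog (k + 2) (1 / 2) +
      ∫ t in (0 : ℝ)..1,
        polylogCover (k + 1) (logHalf + (t : ℂ) * (ζ - logHalf)) *
          (Complex.exp (logHalf + (t : ℂ) * (ζ - logHalf)) /
            (1 + Complex.exp (logHalf + (t : ℂ) * (ζ - logHalf)))) * (ζ - logHalf)

/-- The normalized polylogarithm `li_k = - Li_k / (2 π i)` near its singularity, in the same
coordinate `ζ`. -/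
def liCover (k : ℕ) (ζ : ℂ) : ℂ :=
  -polylogCover k ζ / (2 * (Real.pi : ℂ) * Complex.I)

/-- The half-plane `Re ζ < log r`. Through `ζ ↦ α + exp ζ` it is the universal cover of the
punctured disc `0 < |z - α| < r`. -/
def logDisc (r : ℝ) : Set ℂ := {ζ | ζ.re < Real.log r}

/-- The iterated monodromy operator `Σ_α^k`, `k ∈ ℤ`: analytic continuation along a loop of winding
number `k` around `α`, for germs written in the coordinate `ζ = log (z - α)`. -/
def sigmaIter (k : ℤ) (g : ℂ → ℂ) : ℂ → ℂ :=
  fun ζ => g (ζ + (k : ℂ) * (2 * (Real.pi : ℂ) * Complex.I))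

/-- `f t`, `0 ≤ t < 1`, is the analytic continuation of the germ of `F` at `γ 0` along the path `γ`
restricted to `[0, 1)`. Only the germ of `f t` at `γ t` matters. -/
def IsContinuationAlong (F : ℂ → ℂ) (γ : C(unitInterval, ℂ)) (f : unitInterval → ℂ → ℂ) : Prop :=
  f 0 =ᶠ[𝓝 (γ 0)] F ∧
    ∀ t : unitInterval, t < 1 →
      AnalyticAt ℂ (f t) (γ t) ∧ ∀ᶠ s in 𝓝 t, f s =ᶠ[𝓝 (γ s)] f t

/-- The germ of `F` at `γ 0` continues along `γ` on `[0, 1)`, through the germs `f t`, and the end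
point `γ 1` is a singularity of the branch so obtained: the continuation does not extend to `γ 1`. -/
def EndsInSingularity (F : ℂ → ℂ) (γ : C(unitInterval, ℂ)) (f : unitInterval → ℂ → ℂ) : Prop :=
  IsContinuationAlong F γ f ∧
    ¬ ∃ h : ℂ → ℂ, AnalyticAt ℂ h (γ 1) ∧ ∀ᶠ s in 𝓝[<] (1 : unitInterval), f s =ᶠ[𝓝 (γ s)] h

/-- The singularity `α = γ 1` reached along `γ` is isolated, with local branch `g`: the end of `γ`
lies in the disc of radius `r` around `α`, and the germ reached there continues along all paths of
the punctured disc, that is, to a holomorphic function `g` of `ζ = log (z - α)` on `logDisc r`. -/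
def IsLocalBranch (γ : C(unitInterval, ℂ)) (f : unitInterval → ℂ → ℂ) (r : ℝ) (g : ℂ → ℂ) : Prop :=
  0 < r ∧ DifferentiableOn ℂ g (logDisc r) ∧
    ∃ t₀ : unitInterval, t₀ < 1 ∧ (∀ t : unitInterval, t₀ ≤ t → γ t ∈ Metric.ball (γ 1) r) ∧
      ∃ ζ₁ ∈ logDisc r, γ 1 + Complex.exp ζ₁ = γ t₀ ∧
        ∀ᶠ ζ in 𝓝 ζ₁, g ζ = f t₀ (γ 1 + Complex.exp ζ)

/-- The monodromy of the local branch `g` is recurrent of order `d ≥ 1`, with coefficients in the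
subfield `K` of `ℂ`. -/
def IsRecurrentOfOrder (K : Subfield ℂ) (r : ℝ) (g : ℂ → ℂ) (d : ℕ) : Prop :=
  1 ≤ d ∧ ∃ c : Fin d → ℂ, (∀ k, c k ∈ K) ∧
    ∀ m : ℕ, ∀ ζ ∈ logDisc r,
      sigmaIter ((m + d : ℕ) : ℤ) g ζ = ∑ k : Fin d, c k * sigmaIter ((m + k : ℕ) : ℤ) g ζ

/-- The singularity at the end of `γ` is isolated and its monodromy is `K`-recurrent. -/
def HasRecurrentMonodromy (K : Subfield ℂ) (γ : C(unitInterval, ℂ))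
    (f : unitInterval → ℂ → ℂ) : Prop :=
  ∃ (r : ℝ) (g : ℂ → ℂ), IsLocalBranch γ f r g ∧ ∃ d : ℕ, IsRecurrentOfOrder K r g d

/-- The recurrent monodromy class: all singularities of the germ `F` at `z₀` are isolated with
recurrent monodromy (coefficients in `ℂ`, that is, in the subfield `⊤`).
The set `Γ` of paths says which branches of `F` are considered: `Set.univ` for the singularities of
all branches, the segments starting at `z₀` for those of the principal branch. -/
def InRecurrentMonodromyClass (Γ : Set C(unitInterval, ℂ)) (F : ℂ → ℂ) (z₀ : ℂ) : Prop :=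
  AnalyticAt ℂ F z₀ ∧
    ∀ γ ∈ Γ, γ 0 = z₀ → ∀ f : unitInterval → ℂ → ℂ, EndsInSingularity F γ f →
      HasRecurrentMonodromy ⊤ γ f

/-- `F(z) = (z - α)^a P(li_1, …, li_n) φ(z)` near `α`, where `li_k` stands for the normalized
polylogarithm with its singularity moved to `α`, `li_k (1 + (z - α))`, and `φ` is holomorphic at
`α`. Here `g` is `F` in the coordinate `ζ = log (z - α)`. -/
def IsPolylogForm (α : ℂ) (r : ℝ) (g : ℂ → ℂ) (a : ℂ) (n : ℕ) (P : MvPolynomial (Fin n) ℂ)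
    (φ : ℂ → ℂ) : Prop :=
  0 < r ∧ r ≤ 1 ∧ DifferentiableOn ℂ φ (Metric.ball α r) ∧
    ∀ ζ ∈ logDisc r, g ζ = Complex.exp (a * ζ) *
      MvPolynomial.eval (fun j : Fin n => liCover (j + 1) ζ) P * φ (α + Complex.exp ζ)

/-- All singularities of the germ `F` at `z₀` (on the branches given by `Γ`) are isolated and are
polylogarithm singularities; `a`, `n`, `P`, `φ` depend on the singularity. -/
def HasPolylogSingularities (Γ : Set C(unitInterval, ℂ)) (F : ℂ → ℂ) (z₀ : ℂ) : Prop :=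
  AnalyticAt ℂ F z₀ ∧
    ∀ γ ∈ Γ, γ 0 = z₀ → ∀ f : unitInterval → ℂ → ℂ, EndsInSingularity F γ f →
      ∃ (r : ℝ) (g : ℂ → ℂ) (a : ℂ) (n : ℕ) (P : MvPolynomial (Fin n) ℂ) (φ : ℂ → ℂ),
        IsLocalBranch γ f r g ∧ IsPolylogForm (γ 1) r g a n P φ

/-- `P(li_1 + k, li_2 + k log z, …, li_n + k (log z)^(n-1) / (n-1)!)`, with the singularity moved
to `α` as above: `log z` becomes `log (1 + (z - α)) = log (1 + exp ζ)`. -/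
def shiftedPolylogValue (n : ℕ) (P : MvPolynomial (Fin n) ℂ) (k : ℤ) (ζ : ℂ) : ℂ :=
  MvPolynomial.eval
    (fun j : Fin n => liCover (j + 1) ζ +
      (k : ℂ) * (Complex.log (1 + Complex.exp ζ) ^ (j : ℕ) / (Nat.factorial j : ℂ))) P

end

/-! In the coordinate `ζ = log (z - α)` a loop of winding number `m` is the translation by `c = 2πi
m`, so everything reduces to how the polylogarithms behave under this translation. By induction, the
change of `Li_{k+1}` plus `c L^k / k!`, with `L = log (1 + e^ζ)`, has zero derivative. It is
therefore constant on the half-plane, and the constant is its limit as `ζ → -∞`. That limit is zero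
because the derivative of `Li_{k+1}` is of polynomial size times `e^{Re ζ}`, so translating by a
fixed imaginary amount has no effect in the limit (`polylogCover_add_int_mul`).

The degrees of `Q` follow because `X_j ↦ X_j + c T^j / j!` is an invertible triangular substitution,
which cannot raise a weighted degree in which `T` has weight zero; neither can its inverse.

For the recurrence, at fixed `ζ` the values `Σ^m F` form a sequence `q^m p(m)` up to a factor free
of `m`, with `q = e^{2πi a}` and `p` a polynomial of degree at most `d = deg P`. Such sequences are
annihilated by `(S - q)^(d+1)`, where `S` is the shift, hence by `M(S)^(d+1)` with `M` the minimal
polynomial of `q` over `K`. This operator depends on neither `ζ` nor `p`. -/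

/-! ### Polylogarithms on the half-plane `Re ζ < 0`. -/

theorem re_logHalf : logHalf.re = Real.log (1 / 2) := by
  simp only [logHalf, Complex.add_re, Complex.ofReal_re, Complex.mul_re, Complex.ofReal_im,
    Complex.I_re, Complex.I_im]
  ring

theorem re_logHalf_neg : logHalf.re < 0 := by
  rw [re_logHalf]
  exact Real.log_neg (by norm_num) (by norm_num)

theorem norm_exp_lt_one {ζ : ℂ} (h : ζ.re < 0) : ‖Complex.exp ζ‖ < 1 := by
  simpa [Complex.norm_exp] using h

theorem one_add_exp_mem_slitPlane {ζ : ℂ} (h : ζ.re < 0) :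
    1 + Complex.exp ζ ∈ Complex.slitPlane :=
  Complex.mem_slitPlane_of_norm_lt_one (norm_exp_lt_one h)

theorem one_add_exp_ne_zero {ζ : ℂ} (h : ζ.re < 0) : 1 + Complex.exp ζ ≠ 0 :=
  Complex.slitPlane_ne_zero (one_add_exp_mem_slitPlane h)

theorem convex_re_neg : Convex ℝ {ζ : ℂ | ζ.re < 0} := convex_halfSpace_re_lt 0

theorem isOpen_re_neg : IsOpen {ζ : ℂ | ζ.re < 0} := isOpen_lt Complex.continuous_re continuous_const

/-- On a convex open set `h` has a primitive `G`, and the segment integral is `G z - G p`; this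
avoids differentiating under the integral sign. -/
theorem hasDerivAt_segment_integral {U : Set ℂ} (hU : Convex ℝ U) (hUo : IsOpen U) {h : ℂ → ℂ}
    (hh : DifferentiableOn ℂ h U) {p ζ : ℂ} (hp : p ∈ U) (hζ : ζ ∈ U) :
    HasDerivAt (fun z => ∫ t in (0 : ℝ)..1, h (p + (t : ℂ) * (z - p)) * (z - p)) (h ζ) ζ := by
  obtain ⟨G, hG⟩ := hU.exists_forall_hasDerivWithinAt hh
  have hG' : ∀ a ∈ U, HasDerivAt G (h a) a := fun a ha => (hG a ha).hasDerivAt (hUo.mem_nhds ha)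
  have key : ∀ z ∈ U, ∫ t in (0 : ℝ)..1, h (p + (t : ℂ) * (z - p)) * (z - p) = G z - G p := by
    intro z hz
    have hmem : ∀ t ∈ Set.uIcc (0 : ℝ) 1, p + (t : ℂ) * (z - p) ∈ U := by
      intro t ht
      rw [Set.uIcc_of_le zero_le_one] at ht
      have := hU.add_smul_sub_mem hp hz ht
      rwa [Complex.real_smul] at this
    have hline : ∀ t : ℝ, HasDerivAt (fun t : ℝ => p + (t : ℂ) * (z - p)) (z - p) t := by
      intro t
      simpa using ((Complex.ofRealCLM.hasDerivAt (x := t)).mul_const (z - p)).const_add p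
    have := intervalIntegral.integral_eq_sub_of_hasDerivAt
      (f := fun t : ℝ => G (p + (t : ℂ) * (z - p)))
      (f' := fun t : ℝ => h (p + (t : ℂ) * (z - p)) * (z - p)) (a := 0) (b := 1)
      (fun t ht => (hG' _ (hmem t ht)).comp_of_eq t (hline t) rfl) ?_
    · simpa using this
    · refine ContinuousOn.intervalIntegrable ?_
      refine ContinuousOn.mul ?_ continuousOn_const
      exact hh.continuousOn.comp (by fun_prop) hmem
  refine ((hG' ζ hζ).sub_const (G p)).congr_of_eventuallyEq ?_
  filter_upwards [hUo.mem_nhds hζ] with z hz using key z hz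

theorem hasDerivAt_log_one_add_exp {ζ : ℂ} (h : ζ.re < 0) :
    HasDerivAt (fun z => Complex.log (1 + Complex.exp z))
      (Complex.exp ζ / (1 + Complex.exp ζ)) ζ :=
  ((Complex.hasDerivAt_exp ζ).const_add 1).clog (one_add_exp_mem_slitPlane h)

theorem hasDerivAt_polylogCover_of_differentiableOn {k : ℕ}
    (hd : DifferentiableOn ℂ (polylogCover (k + 1)) {ζ | ζ.re < 0}) {ζ : ℂ} (h : ζ.re < 0) :
    HasDerivAt (polylogCover (k + 2))
      (polylogCover (k + 1) ζ * (Complex.exp ζ / (1 + Complex.exp ζ))) ζ := by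
  have hh : DifferentiableOn ℂ
      (fun ξ => polylogCover (k + 1) ξ * (Complex.exp ξ / (1 + Complex.exp ξ)))
      {ζ | ζ.re < 0} := by
    refine hd.mul (DifferentiableOn.div ?_ ?_ fun x hx => one_add_exp_ne_zero hx)
    · exact Complex.differentiable_exp.differentiableOn
    · exact (Complex.differentiable_exp.const_add 1).differentiableOn
  have := (hasDerivAt_segment_integral convex_re_neg isOpen_re_neg hh re_logHalf_neg h).const_add
    (polylog (k + 2) (1 / 2))
  refine this.congr_of_eventuallyEq (Eventually.of_forall fun z => ?_)
  simp only [polylogCover]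

theorem differentiableOn_polylogCover (k : ℕ) :
    DifferentiableOn ℂ (polylogCover (k + 1)) {ζ | ζ.re < 0} := by
  induction k with
  | zero =>
    have : polylogCover (0 + 1) = fun ζ => -(ζ - (Real.pi : ℂ) * Complex.I) := by
      funext ζ
      simp only [polylogCover]
    rw [this]
    fun_prop
  | succ k ih =>
    exact fun ζ h =>
      (hasDerivAt_polylogCover_of_differentiableOn ih h).differentiableAt.differentiableWithinAt

theorem hasDerivAt_polylogCover (k : ℕ) {ζ : ℂ} (h : ζ.re < 0) :
    HasDerivAt (polylogCover (k + 2))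
      (polylogCover (k + 1) ζ * (Complex.exp ζ / (1 + Complex.exp ζ))) ζ :=
  hasDerivAt_polylogCover_of_differentiableOn (differentiableOn_polylogCover k) h

/-! ### Growth near the singularity, `Re ζ → -∞`. -/

theorem norm_exp_div_one_add_exp_le {ζ : ℂ} (h : ζ.re ≤ Real.log (1 / 2)) :
    ‖Complex.exp ζ / (1 + Complex.exp ζ)‖ ≤ 2 * Real.exp ζ.re := by
  have h1 : ‖Complex.exp ζ‖ ≤ 1 / 2 := by
    rw [Complex.norm_exp, ← Real.exp_log (show (0 : ℝ) < 1 / 2 by norm_num)]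
    exact Real.exp_le_exp.2 h
  have h2 : 1 / 2 ≤ ‖1 + Complex.exp ζ‖ := by
    have := norm_sub_norm_le (1 : ℂ) (-Complex.exp ζ)
    rw [norm_one, norm_neg, sub_neg_eq_add] at this
    linarith
  rw [norm_div, div_le_iff₀ (by linarith), ← Complex.norm_exp]
  nlinarith [norm_nonneg (Complex.exp ζ)]

theorem two_mul_exp_re_le_one {ζ : ℂ} (h : ζ.re ≤ Real.log (1 / 2)) : 2 * Real.exp ζ.re ≤ 1 := by
  have := Real.exp_le_exp.2 h
  rw [Real.exp_log (by norm_num)] at this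
  linarith

/-- A crude bound suffices, since an exponential will beat any power: the kernel `e^ξ / (1 + e^ξ)`
has norm at most 1 here, so each integration costs one factor of the segment length. -/
theorem exists_norm_polylogCover_le (k : ℕ) : ∃ C : ℝ, 0 ≤ C ∧ ∀ ζ : ℂ,
    ζ.re ≤ Real.log (1 / 2) → ‖polylogCover (k + 1) ζ‖ ≤ C * (1 + ‖ζ‖) ^ (k + 1) := by
  induction k with
  | zero =>
    refine ⟨1 + ‖(Real.pi : ℂ) * Complex.I‖, by positivity, fun ζ _ => ?_⟩
    simp only [zero_add, polylogCover, norm_neg, pow_one]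
    have := norm_sub_le ζ ((Real.pi : ℂ) * Complex.I)
    nlinarith [norm_nonneg ζ, norm_nonneg ((Real.pi : ℂ) * Complex.I)]
  | succ k ih =>
    obtain ⟨C, hC, hb⟩ := ih
    -- `B (1 + ‖ζ‖)` dominates both the length of the segment and `1 + ‖ξ‖` for every `ξ` on it.
    set B := 1 + ‖logHalf‖ with hB
    have hB1 : 1 ≤ B := by simp [hB]
    refine ⟨‖polylog (k + 2) (1 / 2)‖ + C * B ^ (k + 2), by positivity, fun ζ hζ => ?_⟩
    have hz : (1 : ℝ) ≤ 1 + ‖ζ‖ := by simp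
    have hsub : ‖ζ - logHalf‖ ≤ B * (1 + ‖ζ‖) := by
      have := norm_sub_le ζ logHalf
      nlinarith [norm_nonneg ζ, norm_nonneg logHalf]
    have hint : ‖∫ t in (0 : ℝ)..1,
        polylogCover (k + 1) (logHalf + (t : ℂ) * (ζ - logHalf)) *
          (Complex.exp (logHalf + (t : ℂ) * (ζ - logHalf)) /
            (1 + Complex.exp (logHalf + (t : ℂ) * (ζ - logHalf)))) * (ζ - logHalf)‖ ≤
        C * (B * (1 + ‖ζ‖)) ^ (k + 1) * 1 * (B * (1 + ‖ζ‖)) * |1 - 0| := by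
      refine intervalIntegral.norm_integral_le_of_norm_le_const fun t ht => ?_
      rw [Set.uIoc_of_le zero_le_one] at ht
      set ξ := logHalf + (t : ℂ) * (ζ - logHalf) with hξ
      have hre : ξ.re ≤ Real.log (1 / 2) := by
        have : ξ.re = logHalf.re + t * (ζ.re - logHalf.re) := by simp [hξ]
        rw [this, re_logHalf]
        nlinarith [ht.1, ht.2]
      have hn : 1 + ‖ξ‖ ≤ B * (1 + ‖ζ‖) := by
        have e : ξ = ((1 - t : ℝ) : ℂ) * logHalf + (t : ℂ) * ζ := by
          rw [hξ]; push_cast; ring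
        have h1 : ‖ξ‖ ≤ (1 - t) * ‖logHalf‖ + t * ‖ζ‖ := by
          rw [e]
          refine (norm_add_le _ _).trans ?_
          rw [norm_mul, norm_mul, Complex.norm_real, Complex.norm_real,
            Real.norm_of_nonneg (by linarith [ht.2]), Real.norm_of_nonneg ht.1.le]
        nlinarith [norm_nonneg ζ, norm_nonneg logHalf, ht.1, ht.2,
          mul_nonneg ht.1.le (norm_nonneg logHalf),
          mul_nonneg (sub_nonneg.2 ht.2) (norm_nonneg ζ),
          mul_nonneg (norm_nonneg ζ) (norm_nonneg logHalf)]
      rw [norm_mul, norm_mul]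
      gcongr
      · refine (hb ξ hre).trans ?_
        gcongr
      · exact (norm_exp_div_one_add_exp_le hre).trans (two_mul_exp_re_le_one hre)
    calc ‖polylogCover (k + 1 + 1) ζ‖
        ≤ ‖polylog (k + 2) (1 / 2)‖ +
          C * (B * (1 + ‖ζ‖)) ^ (k + 1) * 1 * (B * (1 + ‖ζ‖)) * |1 - 0| := by
          simp only [polylogCover]
          exact (norm_add_le _ _).trans (by gcongr)
      _ = ‖polylog (k + 2) (1 / 2)‖ * 1 + C * B ^ (k + 2) * (1 + ‖ζ‖) ^ (k + 2) := by
          rw [sub_zero, abs_one, mul_pow]; ring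
      _ ≤ ‖polylog (k + 2) (1 / 2)‖ * (1 + ‖ζ‖) ^ (k + 2) +
          C * B ^ (k + 2) * (1 + ‖ζ‖) ^ (k + 2) := by
          gcongr
          exact one_le_pow₀ hz
      _ = _ := by ring

/-- Mean value inequality on a vertical segment of fixed length `|b|`, where the derivative is at
most a power of `x` times `e^{-x}`. This fixes the integration constant in the monodromy formula. -/
theorem tendsto_polylogCover_sub (k : ℕ) (b : ℝ) :
    Tendsto (fun x : ℝ => polylogCover (k + 2) ((-x : ℝ) + (b : ℂ) * Complex.I) -
      polylogCover (k + 2) ((-x : ℝ) : ℂ)) atTop (𝓝 0) := by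
  obtain ⟨C, hC, hb⟩ := exists_norm_polylogCover_le k
  have hlim : Tendsto (fun x : ℝ => C * (x + (1 + |b|)) ^ (k + 1) * (2 * Real.exp (-x)) * |b|)
      atTop (𝓝 0) := by
    have := ((Real.tendsto_pow_mul_exp_neg_atTop_nhds_zero (k + 1)).comp
      (tendsto_atTop_add_const_right atTop (1 + |b|) tendsto_id)).const_mul
        (C * 2 * |b| * Real.exp (1 + |b|))
    rw [mul_zero] at this
    refine this.congr fun x => ?_
    have e : Real.exp (-x) = Real.exp (1 + |b|) * Real.exp (-(x + (1 + |b|))) := by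
      rw [← Real.exp_add]; congr 1; ring
    simp only [Function.comp, id]
    rw [e]; ring
  refine squeeze_zero_norm' ?_ hlim
  filter_upwards [eventually_ge_atTop (-Real.log (1 / 2)), eventually_ge_atTop 0] with x hx hx0
  have hseg : ∀ z ∈ segment ℝ ((-x : ℝ) : ℂ) ((-x : ℝ) + (b : ℂ) * Complex.I),
      z.re = -x ∧ ‖z‖ ≤ x + |b| := by
    intro z hz
    rw [segment_eq_image'] at hz
    obtain ⟨t, ht, rfl⟩ := hz
    refine ⟨by simp, ?_⟩
    refine (norm_add_le _ _).trans ?_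
    rw [add_sub_cancel_left, norm_smul, norm_mul, Complex.norm_I, Complex.norm_real,
      Complex.norm_real, norm_neg, Real.norm_of_nonneg hx0, Real.norm_of_nonneg ht.1,
      Real.norm_eq_abs, mul_one]
    nlinarith [abs_nonneg b, ht.2]
  have hneg : -x < 0 := by
    have := Real.log_neg (show (0 : ℝ) < 1 / 2 by norm_num) (by norm_num)
    linarith
  have hmv := (convex_segment ((-x : ℝ) : ℂ) ((-x : ℝ) + (b : ℂ) * Complex.I)
    (𝕜 := ℝ)).norm_image_sub_le_of_norm_hasDerivWithin_le
    (f := polylogCover (k + 2)) (C := C * (x + (1 + |b|)) ^ (k + 1) * (2 * Real.exp (-x)))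
    (fun z hz => (hasDerivAt_polylogCover k (by rw [(hseg z hz).1]; exact hneg)).hasDerivWithinAt)
    (fun z hz => ?_) (left_mem_segment _ _ _) (right_mem_segment _ _ _)
  · refine hmv.trans_eq ?_
    rw [add_sub_cancel_left, norm_mul, Complex.norm_I, Complex.norm_real, Real.norm_eq_abs, mul_one]
  · obtain ⟨h1, h2⟩ := hseg z hz
    have h3 : z.re ≤ Real.log (1 / 2) := by rw [h1]; linarith
    have h4 : 1 + ‖z‖ ≤ x + (1 + |b|) := by linarith
    rw [norm_mul, ← h1]
    gcongr
    · refine (hb z h3).trans ?_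
      gcongr
    · exact norm_exp_div_one_add_exp_le h3

/-! ### Monodromy of the polylogarithms. -/

theorem exp_add_int_mul_two_pi_I (ζ : ℂ) (m : ℤ) :
    Complex.exp (ζ + (m : ℂ) * (2 * (Real.pi : ℂ) * Complex.I)) = Complex.exp ζ :=
  Complex.exp_periodic.int_mul m ζ

theorem re_add_int_mul_two_pi_I (ζ : ℂ) (m : ℤ) :
    (ζ + (m : ℂ) * (2 * (Real.pi : ℂ) * Complex.I)).re = ζ.re := by
  simp

theorem tendsto_log_one_add_exp_neg :
    Tendsto (fun x : ℝ => Complex.log (1 + Complex.exp ((-x : ℝ) : ℂ))) atTop (𝓝 0) := by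
  have h1 : Tendsto (fun x : ℝ => Complex.exp ((-x : ℝ) : ℂ)) atTop (𝓝 0) := by
    rw [tendsto_zero_iff_norm_tendsto_zero]
    simpa [Complex.norm_exp] using Real.tendsto_exp_neg_atTop_nhds_zero
  have h2 : Tendsto (fun x : ℝ => 1 + Complex.exp ((-x : ℝ) : ℂ)) atTop (𝓝 1) := by
    simpa using h1.const_add 1
  simpa using h2.clog (by simp)

theorem polylogCover_add_int_mul (k : ℕ) (m : ℤ) {ζ : ℂ} (h : ζ.re < 0) :
    polylogCover (k + 1) (ζ + (m : ℂ) * (2 * (Real.pi : ℂ) * Complex.I)) =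
      polylogCover (k + 1) ζ - (m : ℂ) * (2 * (Real.pi : ℂ) * Complex.I) *
        (Complex.log (1 + Complex.exp ζ) ^ k / (Nat.factorial k : ℂ)) := by
  induction k generalizing ζ with
  | zero => simp [polylogCover]; ring
  | succ k ih =>
    set c : ℂ := (m : ℂ) * (2 * (Real.pi : ℂ) * Complex.I) with hc
    set D : ℂ → ℂ := fun z => polylogCover (k + 2) (z + c) - polylogCover (k + 2) z +
      c * (Complex.log (1 + Complex.exp z) ^ (k + 1) / (Nat.factorial (k + 1) : ℂ)) with hD
    have hderiv : ∀ z : ℂ, z.re < 0 → HasDerivAt D 0 z := by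
      intro z hz
      have hz' : (z + c).re < 0 := by rwa [hc, re_add_int_mul_two_pi_I]
      have h1 := (hasDerivAt_polylogCover k hz').comp_add_const z c
      have h2 := hasDerivAt_polylogCover k hz
      have h3 := (((hasDerivAt_log_one_add_exp hz).pow (k + 1)).div_const
        (Nat.factorial (k + 1) : ℂ)).const_mul c
      have h4 := (h1.sub h2).add h3
      -- The kernel is periodic and equals `L'`, so the induction hypothesis contributes `-c L^k L'
      -- / k!`, which cancels the derivative of `c L^(k+1) / (k+1)!`.
      refine h4.congr_deriv ?_
      rw [ih hz, hc, exp_add_int_mul_two_pi_I, Nat.factorial_succ]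
      have hf : (Nat.factorial k : ℂ) ≠ 0 := by exact_mod_cast Nat.factorial_ne_zero k
      have hk : (k : ℂ) + 1 ≠ 0 := by exact_mod_cast Nat.succ_ne_zero k
      have he := one_add_exp_ne_zero hz
      push_cast
      field_simp
      ring
    have hconst : ∀ z : ℂ, z.re < 0 → D z = D ζ := fun z hz =>
      isOpen_re_neg.is_const_of_deriv_eq_zero convex_re_neg.isPreconnected
        (fun w hw => (hderiv w hw).differentiableAt.differentiableWithinAt)
        (fun w hw => (hderiv w hw).deriv) hz h
    have hlim : Tendsto (fun x : ℝ => D ((-x : ℝ) : ℂ)) atTop (𝓝 0) := by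
      have h1 := tendsto_polylogCover_sub k (m * (2 * Real.pi))
      have h2 := (((tendsto_log_one_add_exp_neg).pow (k + 1)).div_const
        (Nat.factorial (k + 1) : ℂ)).const_mul c
      have h3 := h1.add h2
      simp only [ne_eq, Nat.succ_ne_zero, not_false_eq_true, zero_pow, zero_div, mul_zero,
        add_zero] at h3
      refine h3.congr fun x => ?_
      have e : (((m : ℝ) * (2 * Real.pi) : ℝ) : ℂ) * Complex.I = c := by
        rw [hc]; push_cast; ring
      rw [hD, e]
    have hzero : D ζ = 0 := by
      refine tendsto_nhds_unique (tendsto_const_nhds.congr' ?_) hlim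
      filter_upwards [eventually_gt_atTop 0] with x hx
      exact (hconst _ (by simpa using hx)).symm
    rw [hD] at hzero
    linear_combination hzero

theorem liCover_add_int_mul (k : ℕ) (m : ℤ) {ζ : ℂ} (h : ζ.re < 0) :
    liCover (k + 1) (ζ + (m : ℂ) * (2 * (Real.pi : ℂ) * Complex.I)) =
      liCover (k + 1) ζ +
        (m : ℂ) * (Complex.log (1 + Complex.exp ζ) ^ k / (Nat.factorial k : ℂ)) := by
  have := Complex.two_pi_I_ne_zero
  rw [liCover, liCover, polylogCover_add_int_mul k m h, div_add' _ _ _ this]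
  congr 1
  ring

/-! ### Weighted degrees of multivariate polynomials. -/

namespace MvPolynomial

theorem weightedTotalDegree_le_iff {σ R : Type*} [CommSemiring R] (w : σ → ℕ)
    (p : MvPolynomial σ R) (d : ℕ) :
    weightedTotalDegree w p ≤ d ↔ ∀ m ∈ p.support, Finsupp.weight w m ≤ d := by
  simp [weightedTotalDegree]

theorem weightedTotalDegree_add_le {σ R : Type*} [CommSemiring R] (w : σ → ℕ)
    (p q : MvPolynomial σ R) :
    weightedTotalDegree w (p + q) ≤ max (weightedTotalDegree w p) (weightedTotalDegree w q) := by
  classical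
  rw [weightedTotalDegree_le_iff]
  intro m hm
  rcases Finset.mem_union.1 (support_add hm) with h | h
  · exact (le_weightedTotalDegree w h).trans (le_max_left _ _)
  · exact (le_weightedTotalDegree w h).trans (le_max_right _ _)

theorem weightedTotalDegree_mul_le {σ R : Type*} [CommSemiring R] (w : σ → ℕ)
    (p q : MvPolynomial σ R) :
    weightedTotalDegree w (p * q) ≤ weightedTotalDegree w p + weightedTotalDegree w q := by
  classical
  rw [weightedTotalDegree_le_iff]
  intro m hm
  obtain ⟨a, ha, b, hb, rfl⟩ := Finset.mem_add.1 (support_mul p q hm)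
  rw [map_add]
  exact add_le_add (le_weightedTotalDegree w ha) (le_weightedTotalDegree w hb)

theorem weightedTotalDegree_monomial_le {σ R : Type*} [CommSemiring R] (w : σ → ℕ)
    (m : σ →₀ ℕ) (r : R) : weightedTotalDegree w (monomial m r) ≤ Finsupp.weight w m := by
  rw [weightedTotalDegree_le_iff]
  intro m' hm'
  rw [Finset.mem_singleton.1 (support_monomial_subset hm')]

theorem weightedTotalDegree_C {σ R : Type*} [CommSemiring R] (w : σ → ℕ) (r : R) :
    weightedTotalDegree w (C r : MvPolynomial σ R) = 0 :=
  Nat.le_zero.1 ((weightedTotalDegree_monomial_le w 0 r).trans_eq (map_zero _))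

theorem weightedTotalDegree_X_le {σ R : Type*} [CommSemiring R] (w : σ → ℕ) (i : σ) :
    weightedTotalDegree w (X i : MvPolynomial σ R) ≤ w i :=
  (weightedTotalDegree_monomial_le w _ _).trans_eq (by simp [Finsupp.weight_single])

theorem weightedTotalDegree_pow_le {σ R : Type*} [CommSemiring R] (w : σ → ℕ)
    (p : MvPolynomial σ R) (n : ℕ) :
    weightedTotalDegree w (p ^ n) ≤ n * weightedTotalDegree w p := by
  induction n with
  | zero => simpa using (weightedTotalDegree_C w (1 : R)).le
  | succ n ih =>
    rw [pow_succ, Nat.succ_mul]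
    exact (weightedTotalDegree_mul_le w _ _).trans (add_le_add_left ih _)

theorem weightedTotalDegree_sum_le {σ R ι : Type*} [CommSemiring R] (w : σ → ℕ) (s : Finset ι)
    (p : ι → MvPolynomial σ R) {d : ℕ} (h : ∀ i ∈ s, weightedTotalDegree w (p i) ≤ d) :
    weightedTotalDegree w (∑ i ∈ s, p i) ≤ d :=
  Finset.sum_induction p (fun q => weightedTotalDegree w q ≤ d)
    (fun a b ha hb => (weightedTotalDegree_add_le w a b).trans (max_le ha hb))
    (by simp [weightedTotalDegree_zero]) h

theorem weightedTotalDegree_prod_le {σ R ι : Type*} [CommSemiring R] (w : σ → ℕ) (s : Finset ι)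
    (p : ι → MvPolynomial σ R) :
    weightedTotalDegree w (∏ i ∈ s, p i) ≤ ∑ i ∈ s, weightedTotalDegree w (p i) := by
  classical
  induction s using Finset.induction_on with
  | empty => simpa using (weightedTotalDegree_C w (1 : R)).le
  | insert a s ha ih =>
    rw [Finset.prod_insert ha, Finset.sum_insert ha]
    exact (weightedTotalDegree_mul_le w _ _).trans (add_le_add_right ih _)

/-- A substitution that does not raise the weights of the variables does not raise the weighted
total degree. -/
theorem weightedTotalDegree_aeval_le {σ τ R : Type*} [CommSemiring R] {v : σ → ℕ} {w : τ → ℕ}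
    {f : σ → MvPolynomial τ R} (hf : ∀ i, weightedTotalDegree w (f i) ≤ v i)
    (p : MvPolynomial σ R) :
    weightedTotalDegree w (aeval f p) ≤ weightedTotalDegree v p := by
  rw [aeval_def, eval₂_eq]
  refine weightedTotalDegree_sum_le w _ _ fun m hm => ?_
  refine le_trans ?_ (le_weightedTotalDegree v hm)
  refine (weightedTotalDegree_mul_le w _ _).trans ?_
  rw [algebraMap_eq, weightedTotalDegree_C, zero_add, Finsupp.weight_apply, Finsupp.sum]
  refine (weightedTotalDegree_prod_le w _ _).trans (Finset.sum_le_sum fun i _ => ?_)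
  rw [smul_eq_mul]
  exact (weightedTotalDegree_pow_le w _ _).trans (Nat.mul_le_mul_left _ (hf i))

end MvPolynomial

/-! ### The triangular substitution and the degrees of `Q`. -/

open MvPolynomial

/-- The substitution `T ↦ T`, `X_j ↦ X_j + c T^j / j!` of polynomials in `T, X_0, …, X_{n-1}`. -/
noncomputable def triangularShift (n : ℕ) (c : ℂ) :
    MvPolynomial (Fin (n + 1)) ℂ →ₐ[ℂ] MvPolynomial (Fin (n + 1)) ℂ :=
  aeval (Fin.cons (X 0) fun j : Fin n => X j.succ + C (c / (Nat.factorial j : ℂ)) * X 0 ^ (j : ℕ))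

theorem triangularShift_X_zero (n : ℕ) (c : ℂ) : triangularShift n c (X 0) = X 0 := by
  simp [triangularShift]

theorem triangularShift_X_succ (n : ℕ) (c : ℂ) (j : Fin n) :
    triangularShift n c (X j.succ) =
      X j.succ + C (c / (Nat.factorial j : ℂ)) * X 0 ^ (j : ℕ) := by
  simp [triangularShift]

theorem triangularShift_neg_apply (n : ℕ) (c : ℂ) (p : MvPolynomial (Fin (n + 1)) ℂ) :
    triangularShift n (-c) (triangularShift n c p) = p := by
  have : (triangularShift n (-c)).comp (triangularShift n c) = AlgHom.id ℂ _ := by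
    refine algHom_ext fun i => ?_
    refine Fin.cases ?_ (fun j => ?_) i
    · simp [triangularShift_X_zero]
    · rw [AlgHom.comp_apply, triangularShift_X_succ, map_add, map_mul, map_pow,
        triangularShift_X_zero, triangularShift_X_succ, ← algebraMap_eq, AlgHom.commutes,
        algebraMap_eq, neg_div, C_neg]
      simp
  exact DFunLike.congr_fun this p

theorem weightedTotalDegree_triangularShift_le (n : ℕ) (c : ℂ) {w : Fin (n + 1) → ℕ} (hw : w 0 = 0)
    (p : MvPolynomial (Fin (n + 1)) ℂ) :
    weightedTotalDegree w (triangularShift n c p) ≤ weightedTotalDegree w p := by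
  refine weightedTotalDegree_aeval_le (fun i => ?_) p
  refine Fin.cases ?_ (fun j => ?_) i
  · exact weightedTotalDegree_X_le w 0
  · rw [Fin.cons_succ]
    refine (weightedTotalDegree_add_le w _ _).trans (max_le (weightedTotalDegree_X_le w _) ?_)
    refine (weightedTotalDegree_mul_le w _ _).trans ?_
    rw [weightedTotalDegree_C, zero_add]
    refine (weightedTotalDegree_pow_le w _ _).trans ?_
    have := weightedTotalDegree_X_le (R := ℂ) w 0
    rw [hw, Nat.le_zero] at this
    simp [this]

/-- The shift by `-c` is the inverse substitution, so the inequality holds in both directions. The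
weights `(0, 1, …, 1)` give the total degree in the `X_j`, and a single unit weight gives the degree
in one `X_j`. -/
theorem weightedTotalDegree_triangularShift (n : ℕ) (c : ℂ) {w : Fin (n + 1) → ℕ} (hw : w 0 = 0)
    (p : MvPolynomial (Fin (n + 1)) ℂ) :
    weightedTotalDegree w (triangularShift n c p) = weightedTotalDegree w p := by
  refine le_antisymm (weightedTotalDegree_triangularShift_le n c hw p) ?_
  conv_lhs => rw [← triangularShift_neg_apply n c p]
  exact weightedTotalDegree_triangularShift_le n (-c) hw _

/-- The polynomial `P(X_0 + c, X_1 + c T, …, X_{n-1} + c T^(n-1) / (n-1)!)`. -/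
noncomputable def shiftedPolynomial (n : ℕ) (P : MvPolynomial (Fin n) ℂ) (c : ℂ) : MvPolynomial (Fin (n + 1)) ℂ :=
  triangularShift n c (rename Fin.succ P)

theorem shiftedPolynomial_eq_aeval (n : ℕ) (P : MvPolynomial (Fin n) ℂ) (c : ℂ) :
    shiftedPolynomial n P c =
      aeval (fun j : Fin n => X j.succ + C (c / (Nat.factorial j : ℂ)) * X 0 ^ (j : ℕ)) P := by
  rw [shiftedPolynomial, triangularShift, aeval_rename]
  rfl

theorem eval_shiftedPolynomial (n : ℕ) (P : MvPolynomial (Fin n) ℂ) (c t : ℂ) (x : Fin n → ℂ) :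
    eval (Fin.cons t x : Fin (n + 1) → ℂ) (shiftedPolynomial n P c) =
      eval (fun j : Fin n => x j + c * (t ^ (j : ℕ) / (Nat.factorial j : ℂ))) P := by
  rw [shiftedPolynomial_eq_aeval, ← coe_aeval_eq_eval, ← coe_aeval_eq_eval]
  simp only [RingHom.coe_coe]
  rw [← AlgHom.comp_apply, comp_aeval]
  congr 2
  funext j
  simp only [map_add, map_mul, map_pow, aeval_X, Fin.cons_succ, Fin.cons_zero, aeval_C,
    Algebra.algebraMap_self, RingHom.id_apply]
  ring

theorem weightedTotalDegree_shiftedPolynomial (n : ℕ) (P : MvPolynomial (Fin n) ℂ) (c : ℂ) :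
    (shiftedPolynomial n P c).weightedTotalDegree
      (Fin.cons 0 (fun _ => 1) : Fin (n + 1) → ℕ) = P.totalDegree := by
  rw [shiftedPolynomial, weightedTotalDegree_triangularShift n c (by simp),
    weightedTotalDegree_rename_of_injective (Fin.succ_injective n), ← weightedTotalDegree_one]
  rfl

theorem degreeOf_succ_shiftedPolynomial (n : ℕ) (P : MvPolynomial (Fin n) ℂ) (c : ℂ) (j : Fin n) :
    (shiftedPolynomial n P c).degreeOf j.succ = P.degreeOf j := by
  rw [← weightedTotalDegree_piSingle, shiftedPolynomial,
    weightedTotalDegree_triangularShift n c (by simp), weightedTotalDegree_piSingle,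
    degreeOf_rename_of_injective (Fin.succ_injective n)]

theorem degreeOf_zero_shiftedPolynomial_le (n : ℕ) (P : MvPolynomial (Fin n) ℂ) (c : ℂ) :
    (shiftedPolynomial n P c).degreeOf 0 ≤ (n - 1) * P.totalDegree := by
  rw [← weightedTotalDegree_piSingle, shiftedPolynomial_eq_aeval]
  -- The variable with index `j` is given weight `j`, which bounds the `T`-degree of its image; each
  -- weight is at most `n - 1`.
  refine (weightedTotalDegree_aeval_le (v := fun j : Fin n => (j : ℕ)) (fun j => ?_) P).trans ?_
  · refine (weightedTotalDegree_add_le _ _ _).trans (max_le ?_ ?_)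
    · exact (weightedTotalDegree_X_le _ _).trans (by simp)
    · refine (weightedTotalDegree_mul_le _ _ _).trans ?_
      rw [weightedTotalDegree_C, zero_add]
      refine (weightedTotalDegree_pow_le _ _ _).trans ?_
      exact (Nat.mul_le_mul_left _ (weightedTotalDegree_X_le _ _)).trans (by simp)
  · rw [weightedTotalDegree_le_iff]
    intro m hm
    refine le_trans ?_ (Nat.mul_le_mul_left _ (le_totalDegree hm))
    rw [Finsupp.weight_apply, Finsupp.sum, Finsupp.sum, Finset.mul_sum]
    refine Finset.sum_le_sum fun i _ => ?_
    rw [smul_eq_mul, mul_comm]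
    exact Nat.mul_le_mul_right _ (Nat.le_sub_one_of_lt i.2)

/-! ### Linear recurrences for `q^m p(m)`. -/

/-- The shift `u ↦ (m ↦ u (m + 1))` on sequences. -/
def seqShift : Module.End ℂ (ℕ → ℂ) := LinearMap.funLeft ℂ ℂ (· + 1)

theorem seqShift_pow_apply (n : ℕ) (u : ℕ → ℂ) (m : ℕ) : (seqShift ^ n) u m = u (m + n) := by
  induction n generalizing m with
  | zero => rfl
  | succ n ih =>
    rw [pow_succ', Module.End.mul_apply]
    exact (ih (m + 1)).trans (by rw [add_right_comm, add_assoc])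

theorem aeval_seqShift_apply (R : Polynomial ℂ) (u : ℕ → ℂ) (m : ℕ) :
    Polynomial.aeval seqShift R u m =
      ∑ i ∈ Finset.range (R.natDegree + 1), R.coeff i * u (m + i) := by
  rw [Polynomial.aeval_eq_sum_range]
  simp [LinearMap.sum_apply, Finset.sum_apply, seqShift_pow_apply]

/-- One application of `S - q` turns `q^m f(m)` into `q^(m+1) (f(m+1) - f(m))`. Hence `d + 1`
applications kill it when `f` is a polynomial of degree at most `d`. -/
theorem aeval_seqShift_X_sub_C_pow (q : ℂ) (n : ℕ) (f : ℂ → ℂ) :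
    Polynomial.aeval seqShift ((Polynomial.X - Polynomial.C q) ^ n) (fun m => q ^ m * f m) =
      fun m => q ^ (m + n) * ((fwdDiff 1)^[n] f) m := by
  induction n with
  | zero => simp
  | succ n ih =>
    rw [pow_succ', map_mul, Module.End.mul_apply, ih]
    funext m
    rw [Function.iterate_succ_apply', fwdDiff]
    simp only [map_sub, Polynomial.aeval_X, Polynomial.aeval_C, LinearMap.sub_apply,
      Module.algebraMap_end_apply, Pi.sub_apply, Pi.smul_apply, smul_eq_mul, seqShift,
      LinearMap.funLeft_apply]
    push_cast
    ring

theorem aeval_seqShift_eq_zero_of_dvd {q : ℂ} {p R : Polynomial ℂ} {d : ℕ} (hp : p.natDegree ≤ d)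
    (hR : (Polynomial.X - Polynomial.C q) ^ (d + 1) ∣ R) :
    Polynomial.aeval seqShift R (fun m => q ^ m * p.eval (m : ℂ)) = 0 := by
  obtain ⟨S, rfl⟩ := hR
  rw [mul_comm, map_mul, Module.End.mul_apply, aeval_seqShift_X_sub_C_pow q _ (fun z => p.eval z),
    Polynomial.fwdDiff_iter_eq_zero_of_degree_lt (Nat.lt_succ_of_le hp)]
  simp only [Pi.zero_apply, mul_zero]
  exact map_zero _

/-- If `q` is algebraic over `K`, the sequences `q ^ m * p m` with `p` polynomial of degree at most
`d` satisfy a common linear recurrence with coefficients in `K`. -/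
theorem exists_common_recurrence (K : Subfield ℂ) {q : ℂ} (hq : IsAlgebraic K q) (d : ℕ) :
    ∃ D : ℕ, 1 ≤ D ∧ ∃ c : Fin D → ℂ, (∀ k, c k ∈ K) ∧ ∀ p : Polynomial ℂ, p.natDegree ≤ d →
      ∀ m : ℕ, q ^ (m + D) * p.eval ((m + D : ℕ) : ℂ) =
        ∑ k : Fin D, c k * (q ^ (m + k) * p.eval ((m + k : ℕ) : ℂ)) := by
  set M := minpoly K q with hM
  have hint : IsIntegral K q := hq.isIntegral
  set R : Polynomial K := M ^ (d + 1) with hR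
  have hmonic : R.Monic := (minpoly.monic hint).pow _
  have hdvd : (Polynomial.X - Polynomial.C q) ^ (d + 1) ∣ R.map (algebraMap K ℂ) := by
    rw [hR, Polynomial.map_pow]
    refine pow_dvd_pow_of_dvd (Polynomial.dvd_iff_isRoot.2 ?_) _
    rw [Polynomial.IsRoot, Polynomial.eval_map_algebraMap, hM, minpoly.aeval]
  -- `R` is monic, so `R(S) u = 0` can be solved for its leading term `u (m + natDegree R)`.
  refine ⟨R.natDegree, ?_, fun k => -((R.coeff k : K) : ℂ),
    fun k => K.neg_mem (R.coeff k).2, fun p hp m => ?_⟩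
  · rw [hR, (minpoly.monic hint).natDegree_pow]
    exact Nat.mul_pos (Nat.succ_pos d) (minpoly.natDegree_pos hint)
  · have h := congr_fun (aeval_seqShift_eq_zero_of_dvd hp hdvd) m
    rw [aeval_seqShift_apply, hmonic.natDegree_map, Finset.sum_range_succ, Pi.zero_apply,
      ← Fin.sum_univ_eq_sum_range (fun i => (R.map (algebraMap K ℂ)).coeff i *
        (q ^ (m + i) * p.eval ((m + i : ℕ) : ℂ)))] at h
    simp only [Polynomial.coeff_map, hmonic.coeff_natDegree, map_one, one_mul] at h
    rw [eq_neg_of_add_eq_zero_right h, ← Finset.sum_neg_distrib]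
    exact Finset.sum_congr rfl fun k _ => (neg_mul _ _).symm

/-! ### Monodromy at polylogarithm singularities. -/

theorem re_neg_of_mem_logDisc {r : ℝ} (hr0 : 0 < r) (hr1 : r ≤ 1) {ζ : ℂ} (hζ : ζ ∈ logDisc r) :
    ζ.re < 0 :=
  lt_of_lt_of_le hζ (Real.log_nonpos hr0.le hr1)

theorem sigmaIter_eq_of_isPolylogForm {α : ℂ} {r : ℝ} {g : ℂ → ℂ} {a : ℂ} {n : ℕ}
    {P : MvPolynomial (Fin n) ℂ} {φ : ℂ → ℂ} (h : IsPolylogForm α r g a n P φ) (k : ℤ) {ζ : ℂ}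
    (hζ : ζ ∈ logDisc r) :
    sigmaIter k g ζ = Complex.exp (2 * (Real.pi : ℂ) * Complex.I * (k : ℂ) * a) *
      Complex.exp (a * ζ) * shiftedPolylogValue n P k ζ * φ (α + Complex.exp ζ) := by
  obtain ⟨hr0, hr1, -, hg⟩ := h
  have hζ' : ζ + (k : ℂ) * (2 * (Real.pi : ℂ) * Complex.I) ∈ logDisc r := by
    rw [logDisc, Set.mem_ofPred_eq, re_add_int_mul_two_pi_I]
    exact hζ
  have hneg := re_neg_of_mem_logDisc hr0 hr1 hζ
  rw [sigmaIter, hg _ hζ', exp_add_int_mul_two_pi_I, shiftedPolylogValue, ← Complex.exp_add]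
  simp only [liCover_add_int_mul _ k hneg]
  congr 3
  ring

/-- For fixed `ζ`, the shifted value of `P` is a polynomial in the winding number. -/
theorem exists_polynomial_shiftedPolylogValue (n : ℕ) (P : MvPolynomial (Fin n) ℂ) (ζ : ℂ) :
    ∃ p : Polynomial ℂ, p.natDegree ≤ P.totalDegree ∧
      ∀ k : ℤ, shiftedPolylogValue n P k ζ = p.eval (k : ℂ) := by
  refine ⟨MvPolynomial.aeval (fun j : Fin n =>
    Polynomial.C (Complex.log (1 + Complex.exp ζ) ^ (j : ℕ) / (Nat.factorial j : ℂ)) *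
      Polynomial.X + Polynomial.C (liCover (j + 1) ζ)) P, ?_, fun k => ?_⟩
  · exact (MvPolynomial.aeval_natDegree_le P le_rfl _
      fun j => Polynomial.natDegree_linear_le).trans_eq (mul_one _)
  · rw [shiftedPolylogValue, ← MvPolynomial.coe_aeval_eq_eval, ← Polynomial.coe_aeval_eq_eval]
    simp only [RingHom.coe_coe]
    rw [← AlgHom.comp_apply, MvPolynomial.comp_aeval]
    congr 2
    funext j
    simp only [map_add, map_mul, Polynomial.aeval_X, Polynomial.aeval_C,
      Algebra.algebraMap_self, RingHom.id_apply]
    ring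

/-- The polynomial in the winding number varies with `ζ`, but its degree bound does not, so one
common recurrence serves all `ζ`. -/
theorem exists_isRecurrentOfOrder_of_isPolylogForm (K : Subfield ℂ) {α : ℂ} {r : ℝ} {g : ℂ → ℂ}
    {a : ℂ} {n : ℕ} {P : MvPolynomial (Fin n) ℂ} {φ : ℂ → ℂ} (h : IsPolylogForm α r g a n P φ)
    (ha : IsAlgebraic K (Complex.exp (2 * (Real.pi : ℂ) * Complex.I * a))) :
    ∃ d : ℕ, IsRecurrentOfOrder K r g d := by
  obtain ⟨D, hD, c, hc, hrec⟩ := exists_common_recurrence K ha P.totalDegree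
  refine ⟨D, hD, c, hc, fun m ζ hζ => ?_⟩
  obtain ⟨p, hp, hval⟩ := exists_polynomial_shiftedPolylogValue n P ζ
  have key : ∀ k : ℕ, sigmaIter (k : ℤ) g ζ =
      Complex.exp (2 * (Real.pi : ℂ) * Complex.I * a) ^ k * p.eval (k : ℂ) *
        (Complex.exp (a * ζ) * φ (α + Complex.exp ζ)) := by
    intro k
    rw [sigmaIter_eq_of_isPolylogForm h _ hζ, hval, ← Complex.exp_nat_mul,
      show 2 * (Real.pi : ℂ) * Complex.I * ((k : ℤ) : ℂ) * a =
        (k : ℂ) * (2 * (Real.pi : ℂ) * Complex.I * a) by push_cast; ring, Int.cast_natCast]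
    ring
  rw [key, hrec p hp m, Finset.sum_mul]
  refine Finset.sum_congr rfl fun k _ => ?_
  rw [key, mul_assoc]

theorem mainTheorem11 :
    -- the iterated monodromies of a polylogarithm singularity
    (∀ (α : ℂ) (r : ℝ) (g : ℂ → ℂ) (a : ℂ) (n : ℕ) (P : MvPolynomial (Fin n) ℂ) (φ : ℂ → ℂ),
      IsPolylogForm α r g a n P φ → ∀ k : ℤ,
        (∀ ζ ∈ logDisc r, sigmaIter k g ζ =
          Complex.exp (2 * (Real.pi : ℂ) * Complex.I * (k : ℂ) * a) * Complex.exp (a * ζ) *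
            shiftedPolylogValue n P k ζ * φ (α + Complex.exp ζ)) ∧
        ∃ Q : MvPolynomial (Fin (n + 1)) ℂ,
          Q.degreeOf 0 ≤ (n - 1) * P.totalDegree ∧
          Q.weightedTotalDegree (Fin.cons 0 (fun _ => 1) : Fin (n + 1) → ℕ) = P.totalDegree ∧
          (∀ j : Fin n, Q.degreeOf j.succ = P.degreeOf j) ∧
          ∀ ζ ∈ logDisc r, shiftedPolylogValue n P k ζ =
            MvPolynomial.eval (Fin.cons (Complex.log (1 + Complex.exp ζ))
              (fun j : Fin n => liCover (j + 1) ζ) : Fin (n + 1) → ℂ) Q) ∧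
    -- a function with polylogarithm singularities is in the recurrent monodromy class
    (∀ (Γ : Set C(unitInterval, ℂ)) (F : ℂ → ℂ) (z₀ : ℂ),
      HasPolylogSingularities Γ F z₀ → InRecurrentMonodromyClass Γ F z₀) ∧
    -- coefficients of the recurrence in a subfield
    (∀ (K : Subfield ℂ) (F : ℂ → ℂ) (γ : C(unitInterval, ℂ)) (f : unitInterval → ℂ → ℂ)
        (r : ℝ) (g : ℂ → ℂ) (a : ℂ) (n : ℕ) (P : MvPolynomial (Fin n) ℂ) (φ : ℂ → ℂ),
      EndsInSingularity F γ f → IsLocalBranch γ f r g → IsPolylogForm (γ 1) r g a n P φ →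
      (∀ m, P.coeff m ∈ K) →
      IsAlgebraic K (Complex.exp (2 * (Real.pi : ℂ) * Complex.I * a)) →
        HasRecurrentMonodromy K γ f) := by
  refine ⟨fun α r g a n P φ h k => ⟨fun ζ hζ => sigmaIter_eq_of_isPolylogForm h k hζ,
    shiftedPolynomial n P k, degreeOf_zero_shiftedPolynomial_le n P k,
    weightedTotalDegree_shiftedPolynomial n P k, degreeOf_succ_shiftedPolynomial n P k,
    fun ζ _ => (eval_shiftedPolynomial n P k _ _).symm⟩, ?_, ?_⟩
  · rintro Γ F z₀ ⟨hF, hsing⟩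
    refine ⟨hF, fun γ hγ h0 f hf => ?_⟩
    obtain ⟨r, g, a, n, P, φ, hloc, hform⟩ := hsing γ hγ h0 f hf
    -- Over `K = ⊤` algebraicity is automatic: `e^{2πi a}` lies in the field itself.
    exact ⟨r, g, hloc, exists_isRecurrentOfOrder_of_isPolylogForm ⊤ hform
      (isAlgebraic_algebraMap (⟨_, Subfield.mem_top _⟩ : (⊤ : Subfield ℂ)))⟩
  · intro K F γ f r g a n P φ _ hloc hform _ ha
    exact ⟨r, g, hloc, exists_isRecurrentOfOrder_of_isPolylogForm K hform ha⟩
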